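/- Let $D \subset \mathbb{R}^n$ be a bounded open set and let $H = L^2(D)$ be the real Hilbert space of square-integrable functions on $D$ (Lebesgue measure), with inner product $\langle\cdot,\cdot\rangle$ and norm $\|\cdot\|$. Let $\mathscr{E}$ be a closed coercive form on $H$, that is, a bilinear form $\mathscr{E} : \mathsf{D}(\mathscr{E}) \times \mathsf{D}(\mathscr{E}) \to \mathbb{R}$ on a dense linear subspace $\mathsf{D}(\mathscr{E}) \subset H$ such that, with $\mathscr{E}_1(u,v) := \langle u, v\rangle + \mathscr{E}(u,v)$ and $\mathscr{E}^s(u,v) := \frac12(\mathscr{E}(u,v) + \mathscr{E}(v,u))$: (a) $\mathscr{E}(u,u) \geq 0$ for all $u \in \mathsf{D}(\mathscr{E})$; (b) (weak sector condition) there is a constant $K$ with $|\mathscr{E}_1(u,v)| \leq K\, \mathscr{E}_1(u,u)^{1/2}\, \mathscr{E}_1(v,v)^{1/2}$ for all $u, v \in \mathsf{D}(\mathscr{E})$; (c) (closedness) $\mathsf{D}(\mathscr{E})$ is complete for the norm $\mathscr{E}_1(u,u)^{1/2} = (\|u\|^2 + \mathscr{E}^s(u,u))^{1/2}$. Let $A_2$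 be the generator of $\mathscr{E}$, i.e. the unbounded operator on $H$ such that $u \in \mathsf{D}(A_2)$ and $A_2u = f$ if and only if $u \in \mathsf{D}(\mathscr{E})$, $f \in H$ and $\mathscr{E}(u,v) = \langle f, v\rangle$ for all $v \in \mathsf{D}(\mathscr{E})$. For $\lambda > 0$ let $(I + \lambda A_2)^{-1}$ be its resolvent, which is a bounded operator on $H$. Suppose that for some $\lambda > 0$ (for instance $\lambda = 1$) and some $m \in \mathbb{N}$ the $m$-th power $(I + \lambda A_2)^{-m}$ is bounded from $L^2(D)$ to $L^\infty(D)$, i.e. there is a finite constant $C$ such that $\|(I+\lambda A_2)^{-m} f\|_{L^\infty(D)} \leq C \|f\|_{L^2(D)}$ for all $f \in L^2(D)$. Then $\mathsf{D}(\mathscr{E})$, equipped with the norm $(\|u\|^2 + \mathscr{E}^s(u,u))^{1/2}$, is compactly embedded in $H$: the inclusion $\mathsf{D}(\mathscr{E}) \hookrightarrow H$ is a compact operator. -/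

import Mathlib

open MeasureTheory Filter Topology
open scoped ENNReal NNReal RealInnerProductSpace

/-- A closed coercive form on a real Hilbert space `H`: a bilinear form on a dense subspace of `H`
which is positive, satisfies the weak sector condition
`|E₁(u, v)| ≤ K E₁(u, u)^(1/2) E₁(v, v)^(1/2)`, where `E₁(u, v) = ⟪u, v⟫ + E(u, v)`,
and is closed: every `E₁`-Cauchy sequence converges with respect to `E₁`. (Only the values on the
diagonal occur in the last condition, so it is a condition on the symmetric part of the form.) -/
structure CoerciveClosedForm (H : Type*) [NormedAddCommGroup H] [InnerProductSpace ℝ H] where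
  domain : Submodule ℝ H
  form : domain →ₗ[ℝ] domain →ₗ[ℝ] ℝ
  dense_domain : Dense (domain : Set H)
  nonneg : ∀ u : domain, 0 ≤ form u u
  sector : ∃ K : ℝ, ∀ u v : domain,
    |⟪(u : H), (v : H)⟫ + form u v|
      ≤ K * √(‖(u : H)‖ ^ 2 + form u u) * √(‖(v : H)‖ ^ 2 + form v v)
  closed : ∀ u : ℕ → domain,
    (∀ ε : ℝ, 0 < ε → ∃ N : ℕ, ∀ j ≥ N, ∀ k ≥ N,
      ‖(u j : H) - (u k : H)‖ ^ 2 + form (u j - u k) (u j - u k) < ε) →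
    ∃ x : domain,
      Tendsto (fun k => ‖(u k : H) - (x : H)‖ ^ 2 + form (u k - x) (u k - x)) atTop (𝓝 0)

namespace CoerciveClosedForm

variable {H : Type*} [NormedAddCommGroup H] [InnerProductSpace ℝ H]

/-! ### The form domain as a Hilbert space -/

/-- The form domain, to be equipped with the inner product `⟪u, v⟫ + Eˢ(u, v)`
(and not with the norm inherited from `H`). -/
def FormDomain (E : CoerciveClosedForm H) : Type _ := E.domain

noncomputable instance (E : CoerciveClosedForm H) : AddCommGroup E.FormDomain :=
  inferInstanceAs (AddCommGroup E.domain)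

noncomputable instance (E : CoerciveClosedForm H) : Module ℝ E.FormDomain :=
  inferInstanceAs (Module ℝ E.domain)

/-- The form, as a bilinear map on the type `E.FormDomain`. -/
def toBilin (E : CoerciveClosedForm H) : E.FormDomain →ₗ[ℝ] E.FormDomain →ₗ[ℝ] ℝ := E.form

/-- The inclusion of the form domain in `H`, as a linear map. -/
def inclₗ (E : CoerciveClosedForm H) : E.FormDomain →ₗ[ℝ] H := E.domain.subtype

/-- The inner product `⟪u, v⟫ + Eˢ(u, v)` on the form domain, `Eˢ` being the symmetric part. -/
@[reducible]
noncomputable def core (E : CoerciveClosedForm H) : InnerProductSpace.Core ℝ E.FormDomain where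
  inner u v := ⟪E.inclₗ u, E.inclₗ v⟫ + (E.toBilin u v + E.toBilin v u) / 2
  conj_inner_symm u v := by
    simp only [conj_trivial]
    rw [real_inner_comm, add_comm (E.toBilin v u)]
  re_inner_nonneg u := by
    have h1 : (0 : ℝ) ≤ ⟪E.inclₗ u, E.inclₗ u⟫ := real_inner_self_nonneg
    have h2 : 0 ≤ E.toBilin u u := E.nonneg u
    simp only [RCLike.re_to_real]
    linarith
  add_left u v w := by
    simp only [map_add, inner_add_left, LinearMap.add_apply]
    ring
  smul_left u v r := by
    simp only [map_smul, inner_smul_left, LinearMap.smul_apply, conj_trivial, smul_eq_mul]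
    ring
  definite u hu := by
    have h1 : (0 : ℝ) ≤ ⟪E.inclₗ u, E.inclₗ u⟫ := real_inner_self_nonneg
    have h2 : 0 ≤ E.toBilin u u := E.nonneg u
    have h3 : (⟪E.inclₗ u, E.inclₗ u⟫ : ℝ) = 0 := by linarith
    exact Subtype.ext (inner_self_eq_zero.mp h3)

noncomputable instance (E : CoerciveClosedForm H) : NormedAddCommGroup E.FormDomain :=
  E.core.toNormedAddCommGroup

noncomputable instance (E : CoerciveClosedForm H) : InnerProductSpace ℝ E.FormDomain :=
  InnerProductSpace.ofCore E.core.toCore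

theorem inner_eq (E : CoerciveClosedForm H) (u v : E.FormDomain) :
    (⟪u, v⟫ : ℝ) = ⟪E.inclₗ u, E.inclₗ v⟫ + (E.toBilin u v + E.toBilin v u) / 2 := rfl

theorem norm_sq_eq (E : CoerciveClosedForm H) (u : E.FormDomain) :
    ‖u‖ ^ 2 = ‖E.inclₗ u‖ ^ 2 + E.toBilin u u := by
  rw [← real_inner_self_eq_norm_sq, inner_eq, real_inner_self_eq_norm_sq]
  ring

theorem norm_inclₗ_le (E : CoerciveClosedForm H) (u : E.FormDomain) : ‖E.inclₗ u‖ ≤ ‖u‖ := by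
  have h2 : 0 ≤ E.toBilin u u := E.nonneg u
  refine (sq_le_sq₀ (norm_nonneg _) (norm_nonneg _)).mp ?_
  rw [norm_sq_eq]
  linarith

/-- The continuous inclusion of the form domain, with its norm `(‖u‖² + E(u, u))^(1/2)`,
in `H`. -/
noncomputable def incl (E : CoerciveClosedForm H) : E.FormDomain →L[ℝ] H :=
  E.inclₗ.mkContinuous 1 fun u => by simpa using E.norm_inclₗ_le u

instance (E : CoerciveClosedForm H) : CompleteSpace E.FormDomain := by
  refine Metric.complete_of_cauchySeq_tendsto fun u hu => ?_
  have hcl : (∀ ε : ℝ, 0 < ε → ∃ N : ℕ, ∀ j ≥ N, ∀ k ≥ N,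
      ‖E.inclₗ (u j - u k)‖ ^ 2 + E.toBilin (u j - u k) (u j - u k) < ε) →
    ∃ x : E.FormDomain, Tendsto
      (fun k => ‖E.inclₗ (u k - x)‖ ^ 2 + E.toBilin (u k - x) (u k - x)) atTop (𝓝 0) :=
    E.closed u
  simp only [← norm_sq_eq, ← dist_eq_norm] at hcl
  obtain ⟨x, hx⟩ := hcl (by
    intro ε hε
    obtain ⟨N, hN⟩ := Metric.cauchySeq_iff.mp hu (√ε) (Real.sqrt_pos.mpr hε)
    refine ⟨N, fun j hj k hk => ?_⟩
    have := (sq_lt_sq₀ dist_nonneg (Real.sqrt_nonneg ε)).mpr (hN j hj k hk)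
    rwa [Real.sq_sqrt hε.le] at this)
  refine ⟨x, ?_⟩
  rw [tendsto_iff_dist_tendsto_zero]
  simpa [Real.sqrt_sq dist_nonneg] using hx.sqrt

/-! ### The generator -/

/-- The graph of the generator: all `(u, f)` with `u` in the form domain, `f ∈ H` and
`E(u, v) = ⟪f, v⟫` for all `v` in the form domain. -/
def generatorGraph (E : CoerciveClosedForm H) : Submodule ℝ (H × H) where
  carrier := {p | ∃ u : E.domain, (u : H) = p.1 ∧ ∀ v : E.domain, E.form u v = ⟪p.2, (v : H)⟫}
  add_mem' := by
    rintro p q ⟨u, hu, hu'⟩ ⟨w, hw, hw'⟩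
    refine ⟨u + w, by simp [hu, hw], fun v => ?_⟩
    simp [hu', hw', inner_add_left]
  zero_mem' := ⟨0, rfl, fun v => by simp⟩
  smul_mem' := by
    rintro c p ⟨u, hu, hu'⟩
    refine ⟨c • u, by simp [hu], fun v => ?_⟩
    simp [hu', inner_smul_left]

theorem mem_generatorGraph (E : CoerciveClosedForm H) (p : H × H) :
    p ∈ E.generatorGraph ↔ ∃ u : E.FormDomain, E.inclₗ u = p.1 ∧
      ∀ v : E.FormDomain, E.toBilin u v = ⟪p.2, E.inclₗ v⟫ := Iff.rfl

/-- The generator `A₂` of the form, as an unbounded operator on `H`: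
`u ∈ D(A₂)` and `A₂ u = f` iff `u ∈ D(E)` and `E(u, v) = ⟪f, v⟫` for all `v ∈ D(E)`. -/
noncomputable def generator (E : CoerciveClosedForm H) : H →ₗ.[ℝ] H :=
  E.generatorGraph.toLinearPMap

theorem eq_of_inner_eq (E : CoerciveClosedForm H) {f g : H}
    (h : ∀ v : E.domain, (⟪f, (v : H)⟫ : ℝ) = ⟪g, (v : H)⟫) : f = g :=
  E.dense_domain.eq_of_inner_left ℝ fun v hv => h ⟨v, hv⟩

/-- The graph of the generator is the graph that defines it. -/
theorem graph_generator (E : CoerciveClosedForm H) :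
    E.generator.graph = E.generatorGraph := by
  refine Submodule.toLinearPMap_graph_eq _ ?_
  rintro ⟨x, f⟩ ⟨u, hu, hu'⟩ hx
  have hu0 : u = 0 := Subtype.ext (hu.trans hx)
  refine E.eq_of_inner_eq fun v => ?_
  rw [← hu' v, hu0]
  simp

/-! ### The resolvent -/

/-- `J` is the inverse of `I + lam A`, where `A` is an unbounded operator on `H`. -/
def IsResolvent (A : H →ₗ.[ℝ] H) (lam : ℝ) (J : H →L[ℝ] H) : Prop :=
  (∀ f : H, ∃ h : J f ∈ A.domain, J f + lam • A ⟨J f, h⟩ = f) ∧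
    ∀ u : A.domain, J ((u : H) + lam • A u) = u

theorem IsResolvent.unique {A : H →ₗ.[ℝ] H} {lam : ℝ} {J J' : H →L[ℝ] H}
    (h : IsResolvent A lam J) (h' : IsResolvent A lam J') : J = J' := by
  ext f
  obtain ⟨hf, hf'⟩ := h.1 f
  have := h'.2 ⟨J f, hf⟩
  rw [hf'] at this
  exact this.symm

/-- The bounded bilinear form `⟪u, v⟫ + lam E(u, v)` on the form domain. -/
theorem exists_bilin (E : CoerciveClosedForm H) {lam : ℝ} (hlam : 0 < lam) :
    ∃ B : E.FormDomain →L[ℝ] E.FormDomain →L[ℝ] ℝ, IsCoercive B ∧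
      ∀ u v, B u v = ⟪E.inclₗ u, E.inclₗ v⟫ + lam * E.toBilin u v := by
  obtain ⟨K, hK⟩ := E.sector
  have hK' : ∀ u v : E.FormDomain,
      |⟪E.inclₗ u, E.inclₗ v⟫ + E.toBilin u v| ≤ K * ‖u‖ * ‖v‖ := by
    intro u v
    have h := hK u v
    have e : ∀ w : E.FormDomain, ‖w‖ = √(‖E.inclₗ w‖ ^ 2 + E.toBilin w w) := fun w => by
      rw [← norm_sq_eq, Real.sqrt_sq (norm_nonneg _)]
    rw [e u, e v]
    exact h
  let b : E.FormDomain →ₗ[ℝ] E.FormDomain →ₗ[ℝ] ℝ :=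
    ((innerₗ H).compl₁₂ E.inclₗ E.inclₗ) + lam • E.toBilin
  have hb : ∀ u v, b u v = ⟪E.inclₗ u, E.inclₗ v⟫ + lam * E.toBilin u v := fun u v => by
    simp [b]
  refine ⟨b.mkContinuous₂ (1 + lam + lam * K) ?_, ⟨min 1 lam, lt_min one_pos hlam, ?_⟩, ?_⟩
  · intro u v
    rw [hb, Real.norm_eq_abs]
    have h1 : |(⟪E.inclₗ u, E.inclₗ v⟫ : ℝ)| ≤ ‖u‖ * ‖v‖ :=
      (abs_real_inner_le_norm _ _).trans
        (mul_le_mul (E.norm_inclₗ_le u) (E.norm_inclₗ_le v) (norm_nonneg _) (norm_nonneg _))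
    have h2 := hK' u v
    rw [abs_le] at h1 h2 ⊢
    constructor <;> nlinarith [h1.1, h1.2, h2.1, h2.2]
  · intro u
    rw [LinearMap.mkContinuous₂_apply, hb, mul_assoc, ← pow_two, norm_sq_eq,
      real_inner_self_eq_norm_sq, mul_add]
    have h2 : 0 ≤ E.toBilin u u := E.nonneg u
    have h3 := min_le_left 1 lam
    have h4 := min_le_right 1 lam
    nlinarith [mul_le_mul_of_nonneg_right h3 (sq_nonneg ‖E.inclₗ u‖),
      mul_le_mul_of_nonneg_right h4 h2]
  · intro u v
    rw [LinearMap.mkContinuous₂_apply, hb]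

/-- For `lam > 0` the operator `I + lam A₂` has a bounded everywhere defined inverse. -/
theorem exists_isResolvent [CompleteSpace H] (E : CoerciveClosedForm H) {lam : ℝ}
    (hlam : 0 < lam) : ∃ J : H →L[ℝ] H, IsResolvent E.generator lam J := by
  obtain ⟨B, hB, hBapp⟩ := E.exists_bilin hlam
  let S : H →L[ℝ] E.FormDomain :=
    (hB.continuousLinearEquivOfBilin.symm : E.FormDomain →L[ℝ] E.FormDomain) ∘L
      ContinuousLinearMap.adjoint E.incl
  have hS : ∀ f v, B (S f) v = ⟪f, E.inclₗ v⟫ := by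
    intro f v
    rw [← hB.continuousLinearEquivOfBilin_apply]
    have : hB.continuousLinearEquivOfBilin (S f) = ContinuousLinearMap.adjoint E.incl f := by
      simp [S]
    rw [this, ContinuousLinearMap.adjoint_inner_left]
    rfl
  have hinj : ∀ u w : E.FormDomain, (∀ v, B u v = B w v) → u = w := by
    intro u w h
    apply hB.continuousLinearEquivOfBilin.injective
    refine ext_inner_right ℝ fun v => ?_
    rw [hB.continuousLinearEquivOfBilin_apply, hB.continuousLinearEquivOfBilin_apply, h]
  refine ⟨E.incl ∘L S, ?_, ?_⟩
  · intro f
    have hmem : ((E.incl ∘L S) f, lam⁻¹ • (f - (E.incl ∘L S) f)) ∈ E.generator.graph := by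
      rw [graph_generator, mem_generatorGraph]
      refine ⟨S f, rfl, fun v => ?_⟩
      have h := hS f v
      rw [hBapp] at h
      change E.toBilin (S f) v = ⟪lam⁻¹ • (f - E.inclₗ (S f)), E.inclₗ v⟫
      rw [inner_smul_left, inner_sub_left, ← h]
      simp only [conj_trivial]
      field_simp
      ring
    obtain ⟨y, hy, hy'⟩ := (LinearPMap.mem_graph_iff _).mp hmem
    have hy1 : (y : H) = (E.incl ∘L S) f := hy
    refine ⟨hy1 ▸ y.2, ?_⟩
    have : (⟨(E.incl ∘L S) f, hy1 ▸ y.2⟩ : E.generator.domain) = y := Subtype.ext hy1.symm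
    rw [this, hy', smul_smul, mul_inv_cancel₀ hlam.ne', one_smul]
    abel
  · intro u
    have hmem := E.generator.mem_graph u
    rw [graph_generator, mem_generatorGraph] at hmem
    obtain ⟨w, hw, hw'⟩ := hmem
    dsimp only at hw hw'
    have : S ((u : H) + lam • E.generator u) = w := by
      refine hinj _ _ fun v => ?_
      rw [hS, hBapp, inner_add_left, inner_smul_left, hw', hw]
      rfl
    rw [ContinuousLinearMap.comp_apply, this]
    exact hw

/-- The resolvent `(I + lam A₂)⁻¹` of the generator, for `lam > 0`. -/
noncomputable def resolvent [CompleteSpace H] (E : CoerciveClosedForm H) (lam : ℝ)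
    (hlam : 0 < lam) : H →L[ℝ] H :=
  (E.exists_isResolvent hlam).choose

theorem isResolvent_resolvent [CompleteSpace H] (E : CoerciveClosedForm H) {lam : ℝ}
    (hlam : 0 < lam) : IsResolvent E.generator lam (E.resolvent lam hlam) :=
  (E.exists_isResolvent hlam).choose_spec

end CoerciveClosedForm

/-- An operator on `L²(μ)` is bounded from `L²(μ)` to `L^∞(μ)`: it maps `L²(μ)` to `L^∞(μ)`, and
`‖T f‖_∞ ≤ C ‖f‖_2` for some finite `C`. -/
def IsBoundedL2Linfty {X : Type*} [MeasurableSpace X] {μ : Measure X}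
    (T : Lp ℝ 2 μ →L[ℝ] Lp ℝ 2 μ) : Prop :=
  ∃ C : ℝ≥0, ∀ f : Lp ℝ 2 μ, eLpNorm (T f) ∞ μ ≤ C * eLpNorm f 2 μ

/-! Write `V` for the form domain with its own norm and `J` for the resolvent. On a finite measure
space, an operator `T` bounded from `L²` to `L^∞` is Hilbert–Schmidt: for orthonormal `eᵢ` the bound
on `T (∑ aᵢ eᵢ)` gives `∑ |T eᵢ|² ≤ C²` almost everywhere, and integration bounds `∑ ‖T eᵢ‖²`. So `J
^ m` is compact (`isCompactOperator_of_isBoundedL2Linfty`).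

The form need not be symmetric, so instead of spectral calculus the descent from `J ^ m` to the
inclusion uses `‖u‖_H³ ≤ C ‖J u‖_H ‖u‖_V²`, a consequence of coercivity and the sector condition,
together with the boundedness of `J` on `V` (`exists_resolvent_estimates`). Applied to `J ^ k x`, it
shows that if `J ^ (k + 1)` is compact from `V` to `H`, so is `J ^ k`; at `k = 0` this is the
inclusion. -/

/-! ### Compactness criteria -/

/-- If `‖P x‖³ ≤ C ‖T x‖ ‖x‖²` with `T` compact, then `P` is compact. -/
theorem IsCompactOperator.of_norm_pow_three_le {X Y Z : Type*} [NormedAddCommGroup X]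
    [NormedSpace ℝ X] [NormedAddCommGroup Y] [NormedSpace ℝ Y] [CompleteSpace Y]
    [NormedAddCommGroup Z] [NormedSpace ℝ Z] {T : X →L[ℝ] Z} (hT : IsCompactOperator T)
    (P : X →L[ℝ] Y) {C : ℝ} (hC : 0 ≤ C) (h : ∀ x, ‖P x‖ ^ 3 ≤ C * ‖T x‖ * ‖x‖ ^ 2) :
    IsCompactOperator P := by
  have hT1 : IsCompact (closure (T '' Metric.closedBall 0 1)) :=
    hT.isCompact_closure_image_closedBall (f := (T : X →ₗ[ℝ] Z)) 1
  have htb := hT1.totallyBounded.subset subset_closure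
  refine (isCompactOperator_iff_isCompact_closure_image_closedBall (P : X →ₗ[ℝ] Y) one_pos).mpr ?_
  refine TotallyBounded.isCompact_of_isClosed (TotallyBounded.closure ?_) isClosed_closure
  rw [Metric.totallyBounded_iff]
  intro ε hε
  -- The 4 bounds `‖x - x'‖²` on the unit ball; `C + 1` keeps the denominator positive when `C = 0`.
  have hδ : 0 < ε ^ 3 / (4 * (C + 1)) := by positivity
  -- The centres of the net are taken inside the image, so that they lift to the unit ball.
  obtain ⟨t, hts, htf, ht⟩ := htb.exists_subset (Metric.dist_mem_uniformity hδ)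
  have hg : ∀ y, ∃ x, y ∈ t → x ∈ Metric.closedBall (0 : X) 1 ∧ T x = y := by
    intro y
    by_cases hy : y ∈ t
    · obtain ⟨x, hx, hxy⟩ := hts hy
      exact ⟨x, fun _ => ⟨hx, hxy⟩⟩
    · exact ⟨0, fun h => absurd h hy⟩
  choose g hg using hg
  refine ⟨(fun y => P (g y)) '' t, htf.image _, ?_⟩
  rintro _ ⟨x, hx, rfl⟩
  obtain ⟨y, hy, hxy⟩ := Set.mem_iUnion₂.mp (ht ⟨x, hx, rfl⟩)
  refine Set.mem_iUnion₂.mpr ⟨P (g y), ⟨y, hy, rfl⟩, ?_⟩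
  obtain ⟨hgy, hTg⟩ := hg y hy
  have hxy' : ‖T (x - g y)‖ < ε ^ 3 / (4 * (C + 1)) := by
    rw [map_sub, hTg, ← dist_eq_norm]; exact hxy
  have hx2 : ‖x - g y‖ ≤ 2 := by
    have h1 := mem_closedBall_zero_iff.mp hx
    have h2 := mem_closedBall_zero_iff.mp hgy
    linarith [norm_sub_le x (g y)]
  have h4 : ‖x - g y‖ ^ 2 ≤ 4 := by nlinarith [norm_nonneg (x - g y)]
  rw [Metric.mem_ball, dist_eq_norm]
  change ‖P x - P (g y)‖ < ε
  rw [← map_sub]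
  refine lt_of_pow_lt_pow_left₀ 3 hε.le ?_
  calc ‖P (x - g y)‖ ^ 3 ≤ C * ‖T (x - g y)‖ * ‖x - g y‖ ^ 2 := h _
    _ ≤ C * ‖T (x - g y)‖ * 4 := by gcongr
    _ ≤ (C + 1) * ‖T (x - g y)‖ * 4 := by gcongr; linarith
    _ < (C + 1) * (ε ^ 3 / (4 * (C + 1))) * 4 := by gcongr
    _ = ε ^ 3 := by field_simp

/-- If the sums `∑ ‖T e‖²` over finite orthonormal sets are bounded, then `T` is small on the
orthogonal complement of some finite-dimensional subspace. -/
theorem exists_finiteDimensional_norm_le_of_sum_sq_le {H : Type*} [NormedAddCommGroup H]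
    [InnerProductSpace ℝ H] {Y : Type*} [NormedAddCommGroup Y] [NormedSpace ℝ Y]
    (T : H →L[ℝ] Y) {M : ℝ}
    (hM : ∀ s : Finset H, Orthonormal ℝ (fun e : (s : Set H) => (e : H)) → ∑ e ∈ s, ‖T e‖ ^ 2 ≤ M)
    {ε : ℝ} (hε : 0 < ε) :
    ∃ V : Submodule ℝ H, FiniteDimensional ℝ V ∧ ∀ x ∈ Vᗮ, ‖T x‖ ≤ ε * ‖x‖ := by
  classical
  -- These cardinalities are at most `M / ε²`. For a set of maximal size, a violating vector in the
  -- orthogonal complement of its span could be normalised and added.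
  let S : Set ℕ := {N | ∃ s : Finset H, s.card = N ∧
    Orthonormal ℝ (fun e : (s : Set H) => (e : H)) ∧ ∀ e ∈ s, ε < ‖T e‖}
  have hne : S.Nonempty := ⟨0, ∅, rfl, by simp, by simp⟩
  have hbdd : BddAbove S := by
    refine ⟨⌊M / ε ^ 2⌋₊, ?_⟩
    rintro _ ⟨s, rfl, hs, hs'⟩
    refine Nat.le_floor ?_
    rw [le_div_iff₀ (by positivity), ← nsmul_eq_mul]
    refine (Finset.card_nsmul_le_sum s (fun e => ‖T e‖ ^ 2) _ fun e he => ?_).trans (hM s hs)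
    have := hs' e he
    gcongr
  obtain ⟨s, hcard, hs, hs'⟩ := Nat.sSup_mem hne hbdd
  refine ⟨Submodule.span ℝ (s : Set H), inferInstance, fun x hx => ?_⟩
  by_contra! hlt
  have hx0 : x ≠ 0 := by
    rintro rfl
    simp at hlt
  have hxn : 0 < ‖x‖ := norm_pos_iff.mpr hx0
  have horth : ∀ e ∈ s, (⟪e, x⟫ : ℝ) = 0 := fun e he =>
    (Submodule.mem_orthogonal _ x).mp hx e (Submodule.subset_span he)
  set y : H := ‖x‖⁻¹ • x with hy
  have hyy : (⟪y, y⟫ : ℝ) = 1 := by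
    rw [real_inner_self_eq_norm_sq, hy, norm_smul, norm_inv, norm_norm,
      inv_mul_cancel₀ hxn.ne', one_pow]
  have hey : ∀ e ∈ s, (⟪e, y⟫ : ℝ) = 0 := fun e he => by
    rw [hy, inner_smul_right, horth e he, mul_zero]
  have hys : y ∉ s := fun h => one_ne_zero (hyy.symm.trans (hey y h))
  have hmem : s.card + 1 ∈ S := by
    refine ⟨insert y s, Finset.card_insert_of_notMem hys, ?_, ?_⟩
    · rw [orthonormal_subtype_iff_ite] at hs ⊢
      intro v hv w hw
      rw [Finset.mem_coe, Finset.mem_insert] at hv hw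
      rcases hv with rfl | hv <;> rcases hw with rfl | hw
      · rw [hyy, if_pos rfl]
      · rw [real_inner_comm, hey w hw, if_neg (ne_of_mem_of_not_mem hw hys).symm]
      · rw [hey v hv, if_neg (ne_of_mem_of_not_mem hv hys)]
      · exact hs v hv w hw
    · intro e he
      rcases Finset.mem_insert.mp he with rfl | he
      · rw [hy, map_smul, norm_smul, norm_inv, norm_norm, inv_mul_eq_div, lt_div_iff₀ hxn]
        exact hlt
      · exact hs' e he
  have := le_csSup hbdd hmem
  omega

/-- A Hilbert–Schmidt operator is compact. -/
theorem isCompactOperator_of_sum_sq_le {H : Type*} [NormedAddCommGroup H]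
    [InnerProductSpace ℝ H] {Y : Type*} [NormedAddCommGroup Y] [NormedSpace ℝ Y]
    [CompleteSpace Y] (T : H →L[ℝ] Y) {M : ℝ}
    (hM : ∀ s : Finset H, Orthonormal ℝ (fun e : (s : Set H) => (e : H)) → ∑ e ∈ s, ‖T e‖ ^ 2 ≤ M) :
    IsCompactOperator T := by
  have hcl : IsClosed {f : H →L[ℝ] Y | IsCompactOperator f} := isClosed_setOfPred_isCompactOperator
  refine hcl.closure_subset (Metric.mem_closure_iff.mpr fun ε hε => ?_)
  obtain ⟨V, hV, hVT⟩ := exists_finiteDimensional_norm_le_of_sum_sq_le T hM (half_pos hε)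
  -- A finite-rank approximant: it differs from `T` by `T` composed with the projection onto `Vᗮ`.
  refine ⟨(T ∘L V.subtypeL) ∘L V.orthogonalProjectionOnto, ?_, ?_⟩
  · have hV' : IsCompactOperator (V.orthogonalProjectionOnto : H →L[ℝ] V) :=
      isCompactOperator_of_locallyCompactSpace_dom _
    exact hV'.clm_comp (T ∘L V.subtypeL)
  · rw [dist_eq_norm]
    refine lt_of_le_of_lt (ContinuousLinearMap.opNorm_le_bound _ (half_pos hε).le fun x => ?_)
      (half_lt_self hε)
    have h1 := hVT _ (V.sub_starProjection_mem_orthogonal x)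
    have h2 : ‖x - V.starProjection x‖ ≤ ‖x‖ := by
      rw [← V.starProjection_orthogonal_val]
      exact Vᗮ.norm_starProjection_apply_le x
    calc _ = ‖T (x - V.starProjection x)‖ := by rw [map_sub]; rfl
      _ ≤ ε / 2 * ‖x - V.starProjection x‖ := h1
      _ ≤ ε / 2 * ‖x‖ := by gcongr

/-! ### Descent from powers of the resolvent to the inclusion -/

namespace CoerciveClosedForm

variable {H : Type*} [NormedAddCommGroup H] [InnerProductSpace ℝ H]

/-- The resolvent maps into the form domain and solves the variational equation there. -/
theorem exists_inclₗ_eq_resolvent [CompleteSpace H] (E : CoerciveClosedForm H) {lam : ℝ}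
    (hlam : 0 < lam) (f : H) : ∃ w : E.FormDomain, E.inclₗ w = E.resolvent lam hlam f ∧
      ∀ v, ⟪E.inclₗ w, E.inclₗ v⟫ + lam * E.toBilin w v = ⟪f, E.inclₗ v⟫ := by
  obtain ⟨h, hf⟩ := (E.isResolvent_resolvent hlam).1 f
  have hmem := E.generator.mem_graph ⟨_, h⟩
  rw [graph_generator, mem_generatorGraph] at hmem
  obtain ⟨w, hw, hw'⟩ := hmem
  refine ⟨w, hw, fun v => ?_⟩
  conv_rhs => rw [← hf]
  rw [hw', hw, inner_add_left, real_inner_smul_left]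

/-- Coercivity and boundedness of `⟪u, v⟫ + lam E(u, v)` for the norm of the form domain. -/
theorem exists_bilin_bounds (E : CoerciveClosedForm H) {lam : ℝ} (hlam : 0 < lam) :
    ∃ c M : ℝ, 0 < c ∧ 0 ≤ M ∧
      (∀ u, c * ‖u‖ ^ 2 ≤ ⟪E.inclₗ u, E.inclₗ u⟫ + lam * E.toBilin u u) ∧
      ∀ u v, ⟪E.inclₗ u, E.inclₗ v⟫ + lam * E.toBilin u v ≤ M * ‖u‖ * ‖v‖ := by
  obtain ⟨K, hK⟩ := E.sector
  have e : ∀ w : E.FormDomain, √(‖E.inclₗ w‖ ^ 2 + E.toBilin w w) = ‖w‖ := fun w => by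
    rw [← norm_sq_eq, Real.sqrt_sq (norm_nonneg _)]
  have hK' : ∀ u v : E.FormDomain,
      |⟪E.inclₗ u, E.inclₗ v⟫ + E.toBilin u v| ≤ K * ‖u‖ * ‖v‖ := fun u v => by
    rw [← e u, ← e v]
    exact hK u v
  -- The upper constant comes from `⟪u, v⟫ + lam E = (1 - lam) ⟪u, v⟫ + lam E₁`.
  refine ⟨min 1 lam, 1 + lam + lam * |K|, lt_min one_pos hlam, by positivity, fun u => ?_,
    fun u v => ?_⟩
  · rw [norm_sq_eq, real_inner_self_eq_norm_sq, mul_add]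
    have h2 : 0 ≤ E.toBilin u u := E.nonneg u
    gcongr
    · exact mul_le_of_le_one_left (sq_nonneg _) (min_le_left _ _)
    · exact min_le_right _ _
  · have h1 : |(⟪E.inclₗ u, E.inclₗ v⟫ : ℝ)| ≤ ‖u‖ * ‖v‖ :=
      (abs_real_inner_le_norm _ _).trans
        (mul_le_mul (E.norm_inclₗ_le u) (E.norm_inclₗ_le v) (norm_nonneg _) (norm_nonneg _))
    have h2 : |⟪E.inclₗ u, E.inclₗ v⟫ + E.toBilin u v| ≤ |K| * (‖u‖ * ‖v‖) := by
      refine (hK' u v).trans ?_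
      rw [mul_assoc]
      gcongr
      exact le_abs_self K
    obtain ⟨h1l, h1u⟩ := abs_le.mp h1
    have h3 := mul_le_mul_of_nonneg_left (abs_le.mp h2).2 hlam.le
    have h4 := mul_le_mul_of_nonneg_left h1l hlam.le
    linarith

/-- The resolvent is bounded on the form domain, and the embedding of the form domain is
controlled by the resolvent. -/
theorem exists_resolvent_estimates [CompleteSpace H] (E : CoerciveClosedForm H) {lam : ℝ}
    (hlam : 0 < lam) : ∃ C : ℝ, 0 ≤ C ∧ ∀ u : E.FormDomain,
      (∃ w : E.FormDomain, E.inclₗ w = E.resolvent lam hlam (E.inclₗ u) ∧ ‖w‖ ≤ C * ‖u‖) ∧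
      ‖E.inclₗ u‖ ^ 3 ≤ C * ‖E.resolvent lam hlam (E.inclₗ u)‖ * ‖u‖ ^ 2 := by
  obtain ⟨c, M, hc, hM, hBc, hBM⟩ := E.exists_bilin_bounds hlam
  refine ⟨c⁻¹ + M ^ 2 * c⁻¹, by positivity, fun u => ?_⟩
  obtain ⟨w, hw, hw'⟩ := E.exists_inclₗ_eq_resolvent hlam (E.inclₗ u)
  -- The equation for `w = J u` is tested with `w` here, and with `u` in `h2`.
  have h1 : c * ‖w‖ ^ 2 ≤ ‖E.inclₗ u‖ * ‖E.inclₗ w‖ :=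
    (hBc w).trans ((hw' w).le.trans (real_inner_le_norm _ _))
  have h2 : ‖E.inclₗ u‖ ^ 2 ≤ M * ‖w‖ * ‖u‖ := by
    rw [← real_inner_self_eq_norm_sq, ← hw' u]
    exact hBM w u
  constructor
  · refine ⟨w, hw, ?_⟩
    have h3 : c * ‖w‖ ≤ ‖u‖ := by
      rcases (norm_nonneg w).eq_or_lt with h0 | h0
      · rw [← h0, mul_zero]; exact norm_nonneg u
      · rw [pow_two, ← mul_assoc] at h1
        refine le_of_mul_le_mul_right (h1.trans ?_) h0
        gcongr
        exacts [E.norm_inclₗ_le u, E.norm_inclₗ_le w]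
    calc ‖w‖ ≤ c⁻¹ * ‖u‖ := by rwa [inv_mul_eq_div, le_div_iff₀' hc]
      _ ≤ _ := by gcongr; linarith [show 0 ≤ M ^ 2 * c⁻¹ by positivity]
  · rw [← hw]
    have h4 : ‖E.inclₗ u‖ ^ 3 ≤ M ^ 2 * c⁻¹ * ‖E.inclₗ w‖ * ‖u‖ ^ 2 := by
      rcases (norm_nonneg (E.inclₗ u)).eq_or_lt with h0 | h0
      · rw [← h0, zero_pow three_ne_zero]; positivity
      -- Squaring `h2` and inserting `h1` leaves one spare factor `‖u‖_H` on each side, which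
      -- cancels.
      · refine le_of_mul_le_mul_right ?_ h0
        have h5 : ‖w‖ ^ 2 ≤ c⁻¹ * (‖E.inclₗ u‖ * ‖E.inclₗ w‖) := by
          rw [inv_mul_eq_div, le_div_iff₀' hc]
          linarith
        calc ‖E.inclₗ u‖ ^ 3 * ‖E.inclₗ u‖ = (‖E.inclₗ u‖ ^ 2) ^ 2 := by ring
          _ ≤ (M * ‖w‖ * ‖u‖) ^ 2 := by gcongr
          _ = M ^ 2 * ‖w‖ ^ 2 * ‖u‖ ^ 2 := by ring
          _ ≤ M ^ 2 * (c⁻¹ * (‖E.inclₗ u‖ * ‖E.inclₗ w‖)) * ‖u‖ ^ 2 := by gcongr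
          _ = _ := by ring
    refine h4.trans ?_
    gcongr
    linarith [inv_pos.mpr hc]

/-- If some power of the resolvent is compact, then the form domain embeds compactly. -/
theorem isCompactOperator_incl_of_resolvent_pow [CompleteSpace H] (E : CoerciveClosedForm H)
    {lam : ℝ} (hlam : 0 < lam) {m : ℕ} (hm : IsCompactOperator (E.resolvent lam hlam ^ m)) :
    IsCompactOperator E.incl := by
  obtain ⟨C, hC, hE⟩ := E.exists_resolvent_estimates hlam
  set J := E.resolvent lam hlam with hJ
  have hpow : ∀ (k : ℕ) (x : E.FormDomain),
      ∃ u : E.FormDomain, E.inclₗ u = (J ^ k) (E.inclₗ x) ∧ ‖u‖ ≤ C ^ k * ‖x‖ := by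
    intro k x
    induction k with
    | zero => exact ⟨x, by simp, by simp⟩
    | succ k ih =>
      obtain ⟨u, hu, hu'⟩ := ih
      obtain ⟨w, hw, hw'⟩ := (hE u).1
      refine ⟨w, by rw [hw, hu, pow_succ']; rfl, hw'.trans ?_⟩
      rw [pow_succ', mul_assoc]
      gcongr
  have hdesc : ∀ k : ℕ, IsCompactOperator ((J ^ k) ∘L E.incl) → IsCompactOperator E.incl := by
    intro k
    induction k with
    | zero => exact id
    | succ k ih =>
      intro hk
      refine ih (hk.of_norm_pow_three_le _ (C := C * (C ^ k) ^ 2) (by positivity) fun x => ?_)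
      obtain ⟨u, hu, hu'⟩ := hpow k x
      have h := (hE u).2
      rw [hu] at h
      have e1 : ((J ^ k) ∘L E.incl) x = (J ^ k) (E.inclₗ x) := rfl
      have e2 : ((J ^ (k + 1)) ∘L E.incl) x = J ((J ^ k) (E.inclₗ x)) := by
        rw [pow_succ']; rfl
      rw [e1, e2]
      calc _ ≤ C * ‖J ((J ^ k) (E.inclₗ x))‖ * ‖u‖ ^ 2 := h
        _ ≤ C * ‖J ((J ^ k) (E.inclₗ x))‖ * (C ^ k * ‖x‖) ^ 2 := by gcongr
        _ = _ := by ring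
  exact hdesc m (hm.comp_clm E.incl)

end CoerciveClosedForm

/-! ### From `L²`–`L^∞` bounds to Hilbert–Schmidt operators -/

section

variable {X : Type*} [MeasurableSpace X] {μ : Measure X}

/-- If `T` is bounded from `L²` to `L^∞`, then `∑ |T e|² ≤ C²` almost everywhere on finite
orthonormal sets. -/
theorem exists_ae_sum_sq_le_of_isBoundedL2Linfty {T : Lp ℝ 2 μ →L[ℝ] Lp ℝ 2 μ}
    (hT : IsBoundedL2Linfty T) : ∃ C : ℝ, ∀ s : Finset (Lp ℝ 2 μ),
      Orthonormal ℝ (fun e : (s : Set (Lp ℝ 2 μ)) => (e : Lp ℝ 2 μ)) →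
      ∀ᵐ x ∂μ, ∑ e ∈ s, (T e x) ^ 2 ≤ C ^ 2 := by
  obtain ⟨C, hC⟩ := hT
  refine ⟨C, fun s hs => ?_⟩
  have hTf : ∀ f : Lp ℝ 2 μ, ∀ᵐ x ∂μ, |T f x| ≤ C * ‖f‖ := by
    intro f
    filter_upwards [ae_le_eLpNormEssSup (f := T f) (μ := μ)] with x hx
    rw [← eLpNorm_exponent_top] at hx
    have := hx.trans (hC f)
    rw [← Lp.enorm_def, ← ofReal_norm, ← ofReal_norm, ← ENNReal.ofReal_coe_nnreal,
      ← ENNReal.ofReal_mul (by positivity), ENNReal.ofReal_le_ofReal_iff (by positivity)] at this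
    exact this
  have hnorm : ∀ a : EuclideanSpace ℝ (s : Set (Lp ℝ 2 μ)),
      ‖∑ e, a e • (e : Lp ℝ 2 μ)‖ = ‖a‖ := by
    intro a
    rw [← sq_eq_sq₀ (norm_nonneg _) (norm_nonneg _), ← real_inner_self_eq_norm_sq,
      hs.inner_sum, EuclideanSpace.norm_sq_eq]
    simp [pow_two]
  have hcomb : ∀ a : EuclideanSpace ℝ (s : Set (Lp ℝ 2 μ)), ∀ᵐ x ∂μ,
      |∑ e, a e * T e x| ≤ C * ‖a‖ := by
    intro a
    have h1 := hTf (∑ e, a e • (e : Lp ℝ 2 μ))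
    rw [hnorm, map_sum] at h1
    have h2 : ∀ᵐ x ∂μ, ∀ e : (s : Set (Lp ℝ 2 μ)), (T (a e • (e : Lp ℝ 2 μ))) x = a e * T e x :=
      ae_all_iff.mpr fun e => by
        rw [map_smul]
        filter_upwards [Lp.coeFn_smul (a e) (T e)] with x hx
        rw [hx, Pi.smul_apply, smul_eq_mul]
    filter_upwards [h1, h2, Lp.coeFn_finsetSum Finset.univ
      (fun e : (s : Set (Lp ℝ 2 μ)) => T (a e • (e : Lp ℝ 2 μ)))] with x h1 h2 h3
    rw [h3, Finset.sum_apply] at h1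
    simpa only [h2] using h1
  -- The null set in `hcomb` depends on `a`; a countable dense set of `a` and continuity give one
  -- null set for all.
  have hdense := ae_all_iff.mpr fun k =>
    hcomb (TopologicalSpace.denseSeq (EuclideanSpace ℝ (s : Set (Lp ℝ 2 μ))) k)
  filter_upwards [hdense] with x hx
  have hall : ∀ a : EuclideanSpace ℝ (s : Set (Lp ℝ 2 μ)), |∑ e, a e * T e x| ≤ C * ‖a‖ := by
    intro a
    refine (TopologicalSpace.denseRange_denseSeq _).induction_on a ?_ hx
    exact isClosed_le (by fun_prop) (by fun_prop)
  -- With `x` fixed, `a` may depend on `x`; this choice gives `‖a‖² ≤ C ‖a‖`.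
  have h := hall (WithLp.toLp 2 fun e => T e x)
  set a : EuclideanSpace ℝ (s : Set (Lp ℝ 2 μ)) := WithLp.toLp 2 fun e => T e x with ha
  have hsum : ∑ e, a e * T e x = ‖a‖ ^ 2 := by
    rw [EuclideanSpace.norm_sq_eq]
    simp [ha, pow_two]
  have hsum' : ∑ e ∈ s, (T e x) ^ 2 = ‖a‖ ^ 2 := by
    rw [EuclideanSpace.norm_sq_eq, ← Finset.sum_coe_sort]
    simp [ha]
  rw [hsum, abs_of_nonneg (by positivity), pow_two] at h
  rw [hsum']
  rcases (norm_nonneg a).eq_or_lt with h0 | h0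
  · rw [← h0, zero_pow two_ne_zero]; positivity
  · have := le_of_mul_le_mul_right h h0
    gcongr

/-- On a finite measure space an operator bounded from `L²` to `L^∞` is compact on `L²`. -/
theorem isCompactOperator_of_isBoundedL2Linfty [IsFiniteMeasure μ]
    {T : Lp ℝ 2 μ →L[ℝ] Lp ℝ 2 μ} (hT : IsBoundedL2Linfty T) : IsCompactOperator T := by
  obtain ⟨C, hC⟩ := exists_ae_sum_sq_le_of_isBoundedL2Linfty hT
  refine isCompactOperator_of_sum_sq_le T (M := ∫ _, C ^ 2 ∂μ) fun s hs => ?_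
  have hnorm : ∀ f : Lp ℝ 2 μ, ‖f‖ ^ 2 = ∫ x, (f x) ^ 2 ∂μ := fun f => by
    rw [← real_inner_self_eq_norm_sq, L2.inner_def]
    simp [pow_two]
  simp only [hnorm]
  have hint : ∀ f : Lp ℝ 2 μ, Integrable (fun x => (f x) ^ 2) μ := fun f =>
    (Lp.memLp f).integrable_sq
  rw [← integral_finsetSum _ fun e _ => hint (T e)]
  exact integral_mono_ae (integrable_finsetSum _ fun e _ => hint (T e)) (integrable_const _)
    (hC s hs)

end

theorem mainTheorem6 (n : ℕ) (D : Set (EuclideanSpace ℝ (Fin n))) (hD : IsOpen D)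
    (hDb : Bornology.IsBounded D)
    (E : CoerciveClosedForm (Lp ℝ 2 (volume.restrict D)))
    (lam : ℝ) (hlam : 0 < lam) (m : ℕ)
    (hm : IsBoundedL2Linfty (E.resolvent lam hlam ^ m)) :
    IsCompactOperator E.incl := by
  have : IsFiniteMeasure (volume.restrict D) :=
    isFiniteMeasure_restrict.mpr hDb.measure_lt_top.ne
  exact E.isCompactOperator_incl_of_resolvent_pow hlam (isCompactOperator_of_isBoundedL2Linfty hm)
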